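/- Let $X\subset\mathbb{R}^n$ be open and let $f\colon X\to\mathbb{R}^n$ be a $C^1$ vector field such that the system $\dot x=f(x)$ is cooperative, i.e. $\frac{\partial f^i}{\partial x^j}(x)\ge 0$ for all $i\neq j$ and all $x\in X$, and irreducible, i.e. for each $x\in X$ the matrix $\big[\frac{\partial f^i}{\partial x^j}(x)\big]$ is irreducible (there is no partition of the indices into two nonempty classes $S,S'$ such that all entries with row index in $S$ and column index in $S'$ vanish). For $x\in X$ let $t\mapsto\phi_t x$, $t\in(\sigma(x),\tau(x))$, denote the nonextendible solution with $\phi_0x=x$. Assume that the system admits a first integral $H\colon X\to\mathbb{R}$ (a continuous function constant on orbits) that is of class $C^1$ and has positive gradient, i.e. $\frac{\partial H}{\partial x^i}(x)>0$ for all $i$ and all $x\in X$. Call $x\in X$ forward nonwandering if for each $\epsilon>0$ and each $0<t<\tau(x)$ there are $y\in X$ with $\tau(y)>t$ and $\theta\in(t,\tau(y))$ such that $\lVert x-y\rVert<\epsilon$ and $\lVert x-\phi_\theta y\rVert<\epsilon$; call it backward nonwandering if for each $\epsilon>0$ and each $\sigma(x)<t<0$ there are $y\in X$ with $\sigma(y)<t$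 and $\theta\in(\sigma(y),t)$ such that $\lVert x-y\rVert<\epsilon$ and $\lVert x-\phi_\theta y\rVert<\epsilon$. Then every point of $X$ that is forward nonwandering or backward nonwandering is an equilibrium, i.e. $\phi_t x=x$ for all $t\in\mathbb{R}$ (equivalently, $f(x)=0$). -/

import Mathlib

open Set

noncomputable section

namespace CoopODE

/-- `ℝⁿ` with the Euclidean norm. -/
abbrev Euc (n : ℕ) : Type := EuclideanSpace ℝ (Fin n)

variable {n : ℕ}

/-- The Jacobian matrix `[∂fⁱ/∂xʲ (x)]`. -/
def jacobian (f : Euc n → Euc n) (x : Euc n) : Matrix (Fin n) (Fin n) ℝ :=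
  Matrix.of fun i j => (fderiv ℝ f x (EuclideanSpace.single j 1)) i

/-- The system `ẋ = f(x)` on `X` is cooperative: all off-diagonal entries of its Jacobian matrix
are nonnegative. -/
def IsCooperative (X : Set (Euc n)) (f : Euc n → Euc n) : Prop :=
  ∀ x ∈ X, ∀ i j, i ≠ j → 0 ≤ jacobian f x i j

/-- A square matrix is irreducible if the indices cannot be split into two nonempty classes
`S` and `Sᶜ` such that all entries with row in `S` and column in `Sᶜ` vanish. (No sign condition is
put on the entries; the diagonal plays no role, and `1 × 1` matrices are irreducible.) -/
def IsIrreducibleMatrix (A : Matrix (Fin n) (Fin n) ℝ) : Prop :=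
  ∀ S : Set (Fin n), S.Nonempty → Sᶜ.Nonempty → ∃ i ∈ S, ∃ j ∈ Sᶜ, A i j ≠ 0

/-- The Jacobian matrix of `f` is irreducible at each point of `X`. -/
def IsIrreducibleSystem (X : Set (Euc n)) (f : Euc n → Euc n) : Prop :=
  ∀ x ∈ X, IsIrreducibleMatrix (jacobian f x)

/-- `γ` is, on the open interval `J ∋ 0`, a solution of `ẋ = f(x)` in `X` with `γ 0 = x`. -/
structure IsSolutionOn (X : Set (Euc n)) (f : Euc n → Euc n) (x : Euc n)
    (J : Set ℝ) (γ : ℝ → Euc n) : Prop where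
  isOpen : IsOpen J
  ordConnected : J.OrdConnected
  zero_mem : (0 : ℝ) ∈ J
  initial : γ 0 = x
  mapsTo : MapsTo γ J X
  isIntegralCurveOn : IsIntegralCurveOn γ (fun _ => f) J

/-- The domain `(σ(x), τ(x))` of the nonextendible solution starting at `x`: the union of all open
intervals around `0` on which a solution starting at `x` exists. -/
def maxInterval (X : Set (Euc n)) (f : Euc n → Euc n) (x : Euc n) : Set ℝ :=
  {t | ∃ J γ, IsSolutionOn X f x J γ ∧ t ∈ J}

/-- The upper end `τ(x)`, possibly `∞`, of the domain of the nonextendible solution. -/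
def exitTime (X : Set (Euc n)) (f : Euc n → Euc n) (x : Euc n) : EReal :=
  sSup ((fun t : ℝ => (t : EReal)) '' maxInterval X f x)

/-- The lower end `σ(x)`, possibly `-∞`, of the domain of the nonextendible solution. -/
def entryTime (X : Set (Euc n)) (f : Euc n → Euc n) (x : Euc n) : EReal :=
  sInf ((fun t : ℝ => (t : EReal)) '' maxInterval X f x)

open Classical in
/-- The local flow `φ_t x`: the value at time `t` of a solution starting at `x` that is defined at
`t`. For a `C¹` vector field on an open set all such solutions agree at `t`. Outside the domain
of the nonextendible solution the value is irrelevant (and set to `x`). -/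
def flow (X : Set (Euc n)) (f : Euc n → Euc n) (t : ℝ) (x : Euc n) : Euc n :=
  if h : t ∈ maxInterval X f x then h.choose_spec.choose t else x

/-- `x` is an equilibrium: its trajectory is defined for all times and is constant. -/
def IsEquilibrium (X : Set (Euc n)) (f : Euc n → Euc n) (x : Euc n) : Prop :=
  x ∈ X ∧ ∀ t : ℝ, t ∈ maxInterval X f x ∧ flow X f t x = x

/-- `x` is forward nonwandering. -/
def IsForwardNonwandering (X : Set (Euc n)) (f : Euc n → Euc n) (x : Euc n) : Prop :=
  x ∈ X ∧ ∀ ε : ℝ, 0 < ε → ∀ t : ℝ, 0 < t → (t : EReal) < exitTime X f x →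
    ∃ y ∈ X, (t : EReal) < exitTime X f y ∧
      ∃ θ : ℝ, t < θ ∧ (θ : EReal) < exitTime X f y ∧
        ‖x - y‖ < ε ∧ ‖x - flow X f θ y‖ < ε

/-- `x` is backward nonwandering. -/
def IsBackwardNonwandering (X : Set (Euc n)) (f : Euc n → Euc n) (x : Euc n) : Prop :=
  x ∈ X ∧ ∀ ε : ℝ, 0 < ε → ∀ t : ℝ, t < 0 → entryTime X f x < (t : EReal) →
    ∃ y ∈ X, entryTime X f y < (t : EReal) ∧
      ∃ θ : ℝ, entryTime X f y < (θ : EReal) ∧ θ < t ∧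
        ‖x - y‖ < ε ∧ ‖x - flow X f θ y‖ < ε

/-- `x` is nonwandering: forward nonwandering or backward nonwandering. -/
def IsNonwandering (X : Set (Euc n)) (f : Euc n → Euc n) (x : Euc n) : Prop :=
  IsForwardNonwandering X f x ∨ IsBackwardNonwandering X f x

/-- `H` is a first integral on `X`: it is continuous and constant on orbits. -/
def IsFirstIntegral (X : Set (Euc n)) (f : Euc n → Euc n) (H : Euc n → ℝ) : Prop :=
  ContinuousOn H X ∧ ∀ x ∈ X, ∀ t ∈ maxInterval X f x, H (flow X f t x) = H x

/-- At each point of `X` all coordinates of the gradient of `H` are positive. -/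
def HasPositiveGradient (X : Set (Euc n)) (H : Euc n → ℝ) : Prop :=
  ∀ x ∈ X, ∀ i, 0 < (gradient H x) i

end CoopODE

end

/-! Along a solution the velocity `u = f(γ)` satisfies `u' = A u`, where `A` is the Jacobian matrix
of `f` at `γ`, and the gradient `p = ∇H(γ)` satisfies the adjoint equation `p' = -pA`, because
`∑ pᵢ uᵢ = 0` identically. Hence, for a fixed set `P` of indices,
`d/dt ∑_{i ∈ P} pᵢ uᵢ = ∑_{i ∈ P, j ∉ P} (pᵢ Aᵢⱼ uⱼ - pⱼ Aⱼᵢ uᵢ)`.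
If `P = {i | uᵢ > 0}` at the given time, cooperativity makes every term nonpositive, and
irreducibility makes one of them negative unless `u = 0`. As `P` maximizes `∑_{i ∈ P} pᵢ uᵢ` at that
time, the function `∑ pᵢ max(uᵢ, 0)` strictly decreases along nonconstant solutions, and a strict
Lyapunov function excludes recurrence. -/

open Filter Topology Matrix

section RealFunctions

theorem strictAntiOn_of_frequently_lt_left {α β : Type*} [ConditionallyCompleteLinearOrder α]
    [TopologicalSpace α] [OrderTopology α] [LinearOrder β] [TopologicalSpace β]
    [ClosedIciTopology β] {g : α → β} {J : Set α} (hJ : J.OrdConnected) (hg : ContinuousOn g J)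
    (h : ∀ t ∈ J, ∃ᶠ s in 𝓝[<] t, g t < g s) : StrictAntiOn g J := by
  intro a ha b hb hab
  have hsub : Icc a b ⊆ J := hJ.out ha hb
  obtain ⟨c, hc, hmax⟩ := isCompact_Icc.exists_isMaxOn (nonempty_Icc.2 hab.le) (hg.mono hsub)
  have exists_gt : ∀ t ∈ Ioc a b, ∃ s ∈ Ico a t, g t < g s := fun t ht ↦
    ((h t (hsub (Ioc_subset_Icc_self ht))).and_eventually (Ico_mem_nhdsLT ht.1)).exists.imp
      fun _ ↦ And.symm
  have hca : c = a := by
    by_contra hne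
    obtain ⟨s, hs, hlt⟩ := exists_gt c ⟨hc.1.lt_of_ne' hne, hc.2⟩
    exact (hmax ⟨hs.1, hs.2.le.trans hc.2⟩).not_gt hlt
  subst hca
  obtain ⟨s, hs, hlt⟩ := exists_gt b (right_mem_Ioc.2 hab)
  exact hlt.trans_le (hmax (Ico_subset_Icc_self hs))

theorem eventually_lt_left_of_hasDerivAt_neg {g : ℝ → ℝ} {g' t : ℝ} (hg : HasDerivAt g g' t)
    (hg' : g' < 0) : ∀ᶠ s in 𝓝[<] t, g t < g s := by
  have hslope : ∀ᶠ s in 𝓝[<] t, slope g t s < 0 :=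
    (hasDerivAt_iff_tendsto_slope.1 hg).mono_left (nhdsWithin_mono t fun _ ↦ ne_of_lt)
      |>.eventually_lt_const hg'
  filter_upwards [hslope, self_mem_nhdsWithin] with s hs hst
  exact (slope_neg_iff_of_le (le_of_lt hst)).1 (slope_comm g t s ▸ hs)

end RealFunctions

section IntegralCurves

variable {E : Type*} [NormedAddCommGroup E] [NormedSpace ℝ E] {v : E → E} {γ γ' : ℝ → E}

theorem eventuallyEq_of_isIntegralCurveAt {t : ℝ} (hv : ContDiffAt ℝ 1 v (γ t))
    (hγ : IsIntegralCurveAt γ (fun _ ↦ v) t) (hγ' : IsIntegralCurveAt γ' (fun _ ↦ v) t)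
    (heq : γ t = γ' t) : γ =ᶠ[𝓝 t] γ' := by
  obtain ⟨K, s, hs, hlip⟩ := hv.exists_lipschitzOnWith
  exact ODE_solution_unique_of_eventually (s := fun _ ↦ s) (Eventually.of_forall fun _ ↦ hlip)
    (hγ.and (hγ.continuousAt hs)) (hγ'.and (hγ'.continuousAt (heq ▸ hs))) heq

theorem eqOn_of_isIntegralCurveAt {J : Set ℝ} (hJ : IsPreconnected J)
    (hv : ∀ t ∈ J, ContDiffAt ℝ 1 v (γ t)) (hγ : ∀ t ∈ J, IsIntegralCurveAt γ (fun _ ↦ v) t)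
    (hγ' : ∀ t ∈ J, IsIntegralCurveAt γ' (fun _ ↦ v) t) {t₀ : ℝ} (ht₀ : t₀ ∈ J)
    (heq : γ t₀ = γ' t₀) : EqOn γ γ' J := by
  have eventuallyEq : ∀ t ∈ J, γ t = γ' t → γ =ᶠ[𝓝 t] γ' := fun t ht ↦
    eventuallyEq_of_isIntegralCurveAt (hv t ht) (hγ t ht) (hγ' t ht)
  have hsub : J ⊆ {t | γ =ᶠ[𝓝 t] γ'} := by
    refine hJ.subset_of_closure_inter_subset isOpen_setOfPred_eventually_nhds
      ⟨t₀, ht₀, eventuallyEq t₀ ht₀ heq⟩ fun t ⟨htc, ht⟩ ↦ eventuallyEq t ht ?_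
    exact tendsto_nhds_unique_of_frequently_eq (hγ t ht).continuousAt (hγ' t ht).continuousAt
      ((mem_closure_iff_frequently.1 htc).mono fun _ ↦ Eventually.self_of_nhds)
  exact fun t ht ↦ (hsub ht).self_of_nhds

theorem exists_flow_continuousAt [CompleteSpace E] {x : E} (hv : ContDiffAt ℝ 1 v x) :
    ∃ ε > 0, ∃ α : E × ℝ → E,
      (∀ᶠ y in 𝓝 x, α (y, 0) = y ∧
        ∀ t ∈ Ioo (-ε) ε, HasDerivAt (fun s ↦ α (y, s)) (v (α (y, t))) t) ∧
      ∀ t ∈ Ioo (-ε) ε, ContinuousAt α (x, t) := by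
  obtain ⟨ε, hε, _, r, _, _, hr, hpl⟩ := IsPicardLindelof.of_contDiffAt_one hv
  obtain ⟨α, hα, hcont⟩ := (hpl 0).exists_forall_mem_closedBall_eq_hasDerivWithinAt_continuousOn
  simp only [zero_sub, zero_add] at hα hcont
  have hball : Metric.closedBall x r ∈ 𝓝 x := Metric.closedBall_mem_nhds x hr
  have hIcc : ∀ t ∈ Ioo (-ε) ε, Icc (-ε) ε ∈ 𝓝 t := fun t ht ↦ Icc_mem_nhds ht.1 ht.2
  refine ⟨ε, hε, α, ?_, fun t ht ↦ hcont.continuousAt (prod_mem_nhds hball (hIcc t ht))⟩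
  filter_upwards [hball] with y hy
  exact ⟨(hα y hy).1, fun t ht ↦
    ((hα y hy).2 t (Ioo_subset_Icc_self ht)).hasDerivAt (hIcc t ht)⟩

theorem exists_flow_mapsTo [CompleteSpace E] {x : E} (hv : ContDiffAt ℝ 1 v x) {U : Set E}
    (hU : U ∈ 𝓝 x) :
    ∃ δ > 0, ∃ α : E → ℝ → E,
      (∀ᶠ y in 𝓝 x, α y 0 = y ∧ MapsTo (α y) (Ioo (-δ) δ) U ∧
        ∀ t ∈ Ioo (-δ) δ, HasDerivAt (α y) (v (α y t)) t) ∧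
      ∀ t ∈ Ioo (-δ) δ, ContinuousAt (fun y ↦ α y t) x := by
  obtain ⟨ε, hε, α, hα, hcont⟩ := exists_flow_continuousAt hv
  have h0 : α (x, 0) = x := hα.self_of_nhds.1
  have hmem : ∀ᶠ q in 𝓝 x ×ˢ 𝓝 (0 : ℝ), α q ∈ U := by
    rw [← nhds_prod_eq]
    exact hcont 0 ⟨neg_lt_zero.2 hε, hε⟩ (h0.symm ▸ hU)
  obtain ⟨p, hp, q, hq, hpq⟩ := eventually_prod_iff.1 hmem
  obtain ⟨δ', hδ', hball⟩ := Metric.eventually_nhds_iff_ball.1 hq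
  rw [Real.ball_eq_Ioo, zero_sub, zero_add] at hball
  have shrink : ∀ {r : ℝ}, min δ' ε ≤ r → Ioo (-min δ' ε) (min δ' ε) ⊆ Ioo (-r) r :=
    fun hr ↦ Ioo_subset_Ioo (neg_le_neg hr) hr
  refine ⟨min δ' ε, lt_min hδ' hε, fun y t ↦ α (y, t), ?_, fun t ht ↦ ?_⟩
  · filter_upwards [hα, hp] with y hy hpy
    exact ⟨hy.1, fun t ht ↦ hpq hpy (hball t (shrink (min_le_left _ _) ht)),
      fun t ht ↦ hy.2 t (shrink (min_le_right _ _) ht)⟩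
  · exact (hcont t (shrink (min_le_right _ _) ht)).comp (f := fun y ↦ (y, t)) (by fun_prop)

end IntegralCurves

section AdjointEquation

theorem tendsto_slope_of_hasStrictFDerivAt {𝕜 E F : Type*} [NontriviallyNormedField 𝕜]
    [NormedAddCommGroup E] [NormedSpace 𝕜 E] [NormedAddCommGroup F] [NormedSpace 𝕜 F]
    {g : E → F} {g' : E →L[𝕜] F} {x : E} (hg : HasStrictFDerivAt g g' x) (v : E) :
    Tendsto (fun q : 𝕜 × E ↦ q.1⁻¹ • (g (q.2 + q.1 • v) - g q.2)) (𝓝[≠] 0 ×ˢ 𝓝 x)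
      (𝓝 (g' v)) := by
  have hle : (𝓝[≠] (0 : 𝕜)) ×ˢ 𝓝 x ≤ 𝓝 (0, x) := by
    rw [nhds_prod_eq]; exact prod_mono_left _ nhdsWithin_le_nhds
  have hpair : Tendsto (fun q : 𝕜 × E ↦ (q.2 + q.1 • v, q.2)) (𝓝[≠] 0 ×ˢ 𝓝 x) (𝓝 (x, x)) := by
    refine Tendsto.mono_left ?_ hle
    have : Continuous fun q : 𝕜 × E ↦ (q.2 + q.1 • v, q.2) := by fun_prop
    simpa only [zero_smul, add_zero] using this.tendsto (0, x)
  have hlittle : (fun q : 𝕜 × E ↦ g (q.2 + q.1 • v) - g q.2 - q.1 • g' v)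
      =o[𝓝[≠] 0 ×ˢ 𝓝 x] fun q : 𝕜 × E ↦ q.1 := by
    refine ((hg.isLittleO.comp_tendsto hpair).congr_left fun q ↦ by simp).trans_isBigO ?_
    refine Asymptotics.IsBigO.of_bound ‖v‖ (Eventually.of_forall fun q ↦ ?_)
    simp [norm_smul, mul_comm]
  have hlim := hlittle.tendsto_inv_smul_nhds_zero.add_const (g' v)
  rw [zero_add] at hlim
  refine hlim.congr' ?_
  filter_upwards [tendsto_fst.eventually self_mem_nhdsWithin] with q (hq : q.1 ≠ 0)
  rw [smul_sub, inv_smul_smul₀ hq, sub_add_cancel]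

/- `H` need not be `C²`: the derivative is obtained as a uniform limit of the derivatives of
`s ↦ ε⁻¹ • (H (γ s + ε • w) - H (γ s))`, which by `hH₀` involve difference quotients of the field
only. -/
theorem hasDerivAt_fderiv_apply_of_isIntegralCurveAt {E F : Type*} [NormedAddCommGroup E]
    [NormedSpace ℝ E] [NormedAddCommGroup F] [NormedSpace ℝ F] {v : E → E} {v' : E →L[ℝ] E}
    {H : E → F} {γ : ℝ → E} {t : ℝ} (hγ : IsIntegralCurveAt γ (fun _ ↦ v) t)
    (hv : HasStrictFDerivAt v v' (γ t)) (hH : ContDiffAt ℝ 1 H (γ t))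
    (hH₀ : ∀ᶠ y in 𝓝 (γ t), fderiv ℝ H y (v y) = 0) (w : E) :
    HasDerivAt (fun s ↦ fderiv ℝ H (γ s) w) (-fderiv ℝ H (γ t) (v' w)) t := by
  have hγt : ContinuousAt γ t := hγ.continuousAt
  have hshift : Tendsto (fun q : ℝ × ℝ ↦ γ q.2 + q.1 • w) (𝓝[≠] 0 ×ˢ 𝓝 t) (𝓝 (γ t)) := by
    have hsmul : Tendsto (fun ε : ℝ ↦ ε • w) (𝓝[≠] 0) (𝓝 0) := by
      have : Continuous fun ε : ℝ ↦ ε • w := by fun_prop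
      simpa only [zero_smul] using (this.tendsto 0).mono_left nhdsWithin_le_nhds
    simpa only [add_zero, Function.comp_apply] using
      (hγt.tendsto.comp tendsto_snd).add (hsmul.comp tendsto_fst)
  have hdiff : ∀ᶠ y in 𝓝 (γ t), DifferentiableAt ℝ H y :=
    (hH.eventually (by simp)).mono fun y hy ↦ hy.differentiableAt (by simp)
  refine hasDerivAt_of_tendstoUniformlyOnFilter (l := 𝓝[≠] (0 : ℝ))
    (f := fun ε s ↦ ε⁻¹ • (H (γ s + ε • w) - H (γ s)))
    (f' := fun ε s ↦ -fderiv ℝ H (γ s + ε • w) (ε⁻¹ • (v (γ s + ε • w) - v (γ s))))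
    (g' := fun _ ↦ -fderiv ℝ H (γ t) (v' w)) ?_ ?_ ?_
  · rw [← tendsto_prod_filter_iff]
    have hquot : Tendsto (fun q : ℝ × ℝ ↦ q.1⁻¹ • (v (γ q.2 + q.1 • w) - v (γ q.2)))
        (𝓝[≠] 0 ×ˢ 𝓝 t) (𝓝 (v' w)) :=
      (tendsto_slope_of_hasStrictFDerivAt hv w).comp (tendsto_id.prodMap hγt.tendsto)
    have hfderiv := (hH.continuousAt_fderiv (by simp)).tendsto.comp hshift
    exact ((isBoundedBilinearMap_apply.continuous.tendsto (fderiv ℝ H (γ t), v' w)).comp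
      (hfderiv.prodMk_nhds hquot)).neg
  · filter_upwards [hshift.eventually (hdiff.and hH₀),
      tendsto_snd.eventually (hγ.and (hγt.eventually (hdiff.and hH₀)))]
      with q ⟨hdiff_shift, hzero_shift⟩ ⟨hderiv, hdiff_curve, hzero_curve⟩
    have hshifted := hdiff_shift.hasFDerivAt.comp_hasDerivAt q.2 (hderiv.add_const (q.1 • w))
    have hcurve := hdiff_curve.hasFDerivAt.comp_hasDerivAt q.2 hderiv
    refine ((hshifted.sub hcurve).const_smul q.1⁻¹).congr_deriv ?_
    simp only [map_smul, map_sub, hzero_shift, hzero_curve, zero_sub, sub_zero, smul_neg, neg_neg]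
  · filter_upwards [hγt.eventually hdiff] with s hs
    exact (hs.hasFDerivAt.hasLineDerivAt w).tendsto_slope_zero

end AdjointEquation

section CutBalance

theorem sum_mul_mulVec_sub_vecMul_mul {ι R : Type*} [Fintype ι] [DecidableEq ι] [NonUnitalRing R]
    (A : Matrix ι ι R) (p u : ι → R) (S : Finset ι) :
    ∑ i ∈ S, (p i * (A *ᵥ u) i - (p ᵥ* A) i * u i) =
      ∑ i ∈ S, ∑ j ∈ Sᶜ, (p i * A i j * u j - p j * A j i * u i) := by
  have antisymm : ∑ i ∈ S, ∑ j ∈ S, (p i * A i j * u j - p j * A j i * u i) = 0 := by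
    simp only [Finset.sum_sub_distrib]
    rw [Finset.sum_comm, sub_self]
  calc ∑ i ∈ S, (p i * (A *ᵥ u) i - (p ᵥ* A) i * u i)
      = ∑ i ∈ S, ∑ j, (p i * A i j * u j - p j * A j i * u i) := by
        simp only [mulVec, vecMul, dotProduct, Finset.mul_sum, Finset.sum_mul,
          Finset.sum_sub_distrib, mul_assoc]
    _ = ∑ i ∈ S, ∑ j ∈ Sᶜ, (p i * A i j * u j - p j * A j i * u i) := by
        simp only [← Finset.sum_add_sum_compl S fun j ↦ p _ * A _ j * u j - p j * A j _ * u _]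
        rw [Finset.sum_add_distrib, antisymm, zero_add]

theorem exists_pos_and_exists_neg_of_dotProduct_eq_zero {ι R : Type*} [Fintype ι] [Ring R]
    [LinearOrder R] [IsStrictOrderedRing R] {p u : ι → R} (hp : ∀ i, 0 < p i) (hu : u ≠ 0)
    (h : p ⬝ᵥ u = 0) : (∃ i, 0 < u i) ∧ ∃ i, u i < 0 := by
  have exists_pos : ∀ {w : ι → R}, w ≠ 0 → p ⬝ᵥ w = 0 → ∃ i, 0 < w i := by
    intro w hw hpw
    obtain ⟨k, hk⟩ := Function.ne_iff.1 hw
    obtain ⟨i, -, hi⟩ := Finset.exists_pos_of_sum_zero_of_exists_nonzero (fun i ↦ p i * w i) hpw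
      ⟨k, Finset.mem_univ k, mul_ne_zero (hp k).ne' hk⟩
    exact ⟨i, pos_of_mul_pos_right hi (hp i).le⟩
  refine ⟨exists_pos hu h, ?_⟩
  simpa using exists_pos (neg_ne_zero.2 hu) (by rw [dotProduct_neg, h, neg_zero])

end CutBalance

namespace CoopODE

variable {n : ℕ} {X : Set (Euc n)} {f : Euc n → Euc n} {H L : Euc n → ℝ}

theorem IsIrreducibleMatrix.sum_mul_mulVec_sub_vecMul_mul_neg {A : Matrix (Fin n) (Fin n) ℝ}
    (hirr : IsIrreducibleMatrix A) (hA : ∀ i j, i ≠ j → 0 ≤ A i j) {p u : Fin n → ℝ}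
    (hp : ∀ i, 0 < p i) (hu : u ≠ 0) (hpu : p ⬝ᵥ u = 0) :
    ∑ i with 0 < u i, (p i * (A *ᵥ u) i - (p ᵥ* A) i * u i) < 0 := by
  obtain ⟨⟨i₀, hi₀⟩, j₀, hj₀⟩ := exists_pos_and_exists_neg_of_dotProduct_eq_zero hp hu hpu
  obtain ⟨j, hj : ¬0 < u j, i, hi, hji⟩ := hirr {j | ¬0 < u j} ⟨j₀, hj₀.not_gt⟩ ⟨i₀, not_not.2 hi₀⟩
  replace hi : 0 < u i := not_not.1 hi
  have ne_of_sign : ∀ i j, 0 < u i → ¬0 < u j → i ≠ j := by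
    rintro i _ hi hj rfl
    exact hj hi
  have outflow_nonpos : ∀ i j, 0 < u i → ¬0 < u j → p i * A i j * u j ≤ 0 := fun i j hi hj ↦
    mul_nonpos_of_nonneg_of_nonpos
      (mul_nonneg (hp i).le (hA i j (ne_of_sign i j hi hj))) (not_lt.1 hj)
  have inflow_nonneg : ∀ i j, 0 < u i → ¬0 < u j → 0 ≤ p j * A j i * u i := fun i j hi hj ↦
    mul_nonneg (mul_nonneg (hp j).le (hA j i (ne_of_sign i j hi hj).symm)) hi.le
  have inflow_pos : 0 < p j * A j i * u i :=
    mul_pos (mul_pos (hp j) ((hA j i (ne_of_sign i j hi hj).symm).lt_of_ne' hji)) hi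
  rw [sum_mul_mulVec_sub_vecMul_mul, ← Finset.sum_product']
  refine Finset.sum_neg' (fun q hq ↦ ?_) ⟨(i, j), by simp [hi, not_lt.1 hj], ?_⟩
  · simp only [Finset.mem_product, Finset.mem_compl, Finset.mem_filter_univ] at hq
    exact sub_nonpos.2 ((outflow_nonpos q.1 q.2 hq.1 hq.2).trans (inflow_nonneg q.1 q.2 hq.1 hq.2))
  · exact sub_neg.2 ((outflow_nonpos i j hi hj).trans_lt inflow_pos)

theorem fderiv_apply_eq_mulVec (f : Euc n → Euc n) (x v : Euc n) (i : Fin n) :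
    fderiv ℝ f x v i = (jacobian f x *ᵥ v) i := by
  conv_lhs => rw [← (EuclideanSpace.basisFun (Fin n) ℝ).sum_repr v]
  simp [mulVec, dotProduct, jacobian, mul_comm]

theorem fderiv_single (H : Euc n → ℝ) (x : Euc n) (i : Fin n) :
    fderiv ℝ H x (EuclideanSpace.single i 1) = gradient H x i := by
  rw [← inner_gradient_left, EuclideanSpace.inner_single_right]
  simp

theorem fderiv_apply_eq_dotProduct (H : Euc n → ℝ) (x v : Euc n) :
    fderiv ℝ H x v = (gradient H x).ofLp ⬝ᵥ v := by
  rw [← inner_gradient_left, PiLp.inner_apply]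
  simp [dotProduct, mul_comm]

namespace IsSolutionOn

variable {x : Euc n} {J J' : Set ℝ} {γ γ' : ℝ → Euc n}

theorem isIntegralCurveAt (h : IsSolutionOn X f x J γ) {t : ℝ} (ht : t ∈ J) :
    IsIntegralCurveAt γ (fun _ ↦ f) t :=
  h.isIntegralCurveOn.isIntegralCurveAt (h.isOpen.mem_nhds ht)

theorem hasDerivAt (h : IsSolutionOn X f x J γ) {t : ℝ} (ht : t ∈ J) :
    HasDerivAt γ (f (γ t)) t :=
  (h.isIntegralCurveAt ht).hasDerivAt

theorem shift (h : IsSolutionOn X f x J γ) {s : ℝ} (hs : s ∈ J) :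
    IsSolutionOn X f (γ s) ((· + s) ⁻¹' J) (fun t ↦ γ (t + s)) where
  isOpen := h.isOpen.preimage (by fun_prop)
  ordConnected := h.ordConnected.preimage_mono fun a b hab ↦ by simpa using hab
  zero_mem := by simpa using hs
  initial := by simp
  mapsTo := fun t ht ↦ h.mapsTo ht
  isIntegralCurveOn := fun t ht ↦
    ((h.hasDerivAt (t := t + s) ht).comp_add_const t s).hasDerivWithinAt

theorem lt_exitTime (h : IsSolutionOn X f x J γ) {t : ℝ} (ht : t ∈ J) :
    (t : EReal) < exitTime X f x := by
  obtain ⟨s, hsJ, hts⟩ : ∃ s ∈ J, t < s :=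
    ((h.isOpen.eventually_mem ht).filter_mono nhdsWithin_le_nhds |>.and
      (self_mem_nhdsWithin (s := Ioi t))).exists
  have hs : s ∈ maxInterval X f x := ⟨J, γ, h, hsJ⟩
  exact (EReal.coe_lt_coe_iff.2 hts).trans_le (le_sSup (mem_image_of_mem _ hs))

theorem entryTime_lt (h : IsSolutionOn X f x J γ) {t : ℝ} (ht : t ∈ J) :
    entryTime X f x < (t : EReal) := by
  obtain ⟨s, hsJ, hst⟩ : ∃ s ∈ J, s < t :=
    ((h.isOpen.eventually_mem ht).filter_mono nhdsWithin_le_nhds |>.and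
      (self_mem_nhdsWithin (s := Iio t))).exists
  have hs : s ∈ maxInterval X f x := ⟨J, γ, h, hsJ⟩
  exact (sInf_le (mem_image_of_mem _ hs)).trans_lt (EReal.coe_lt_coe_iff.2 hst)

theorem eqOn (hX : IsOpen X) (hf : ContDiffOn ℝ 1 f X) (h : IsSolutionOn X f x J γ)
    (h' : IsSolutionOn X f x J' γ') : EqOn γ γ' (J ∩ J') :=
  eqOn_of_isIntegralCurveAt (h.ordConnected.inter h'.ordConnected).isPreconnected
    (fun _ ht ↦ hf.contDiffAt (hX.mem_nhds (h.mapsTo ht.1))) (fun _ ht ↦ h.isIntegralCurveAt ht.1)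
    (fun _ ht ↦ h'.isIntegralCurveAt ht.2) ⟨h.zero_mem, h'.zero_mem⟩
    (h.initial.trans h'.initial.symm)

theorem flow_eq (hX : IsOpen X) (hf : ContDiffOn ℝ 1 f X) (h : IsSolutionOn X f x J γ) {t : ℝ}
    (ht : t ∈ J) : flow X f t x = γ t := by
  have hmem : t ∈ maxInterval X f x := ⟨J, γ, h, ht⟩
  rw [flow, dif_pos hmem]
  obtain ⟨hsol, htJ⟩ := hmem.choose_spec.choose_spec
  exact hsol.eqOn hX hf h ⟨htJ, ht⟩

theorem vectorField_ne_zero (hX : IsOpen X) (hf : ContDiffOn ℝ 1 f X)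
    (h : IsSolutionOn X f x J γ) (hfx : f x ≠ 0) {t : ℝ} (ht : t ∈ J) : f (γ t) ≠ 0 := by
  intro hft
  have hconst : IsIntegralCurve (fun _ ↦ γ t) (fun _ ↦ f) := fun s ↦ by
    simpa only [hft] using hasDerivAt_const s (γ t)
  have heq : EqOn γ (fun _ ↦ γ t) J := eqOn_of_isIntegralCurveAt h.ordConnected.isPreconnected
    (fun _ hs ↦ hf.contDiffAt (hX.mem_nhds (h.mapsTo hs))) (fun _ ↦ h.isIntegralCurveAt)
    (fun s _ ↦ hconst.isIntegralCurveAt s) ht rfl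
  exact hfx (by rw [← h.initial, heq h.zero_mem, hft])

end IsSolutionOn

theorem exists_isSolutionOn_of_lt_exitTime {x : Euc n} {t : ℝ} (ht : 0 ≤ t)
    (h : (t : EReal) < exitTime X f x) : ∃ J γ, IsSolutionOn X f x J γ ∧ t ∈ J := by
  obtain ⟨_, ⟨s, ⟨J, γ, hγ, hs⟩, rfl⟩, hts⟩ := lt_sSup_iff.1 h
  exact ⟨J, γ, hγ, hγ.ordConnected.out hγ.zero_mem hs ⟨ht, (EReal.coe_lt_coe_iff.1 hts).le⟩⟩

theorem exists_isSolutionOn_of_entryTime_lt {x : Euc n} {t : ℝ} (ht : t ≤ 0)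
    (h : entryTime X f x < (t : EReal)) : ∃ J γ, IsSolutionOn X f x J γ ∧ t ∈ J := by
  obtain ⟨_, ⟨s, ⟨J, γ, hγ, hs⟩, rfl⟩, hts⟩ := sInf_lt_iff.1 h
  exact ⟨J, γ, hγ, hγ.ordConnected.out hs hγ.zero_mem ⟨(EReal.coe_lt_coe_iff.1 hts).le, ht⟩⟩

theorem exists_local_flow (hX : IsOpen X) (hf : ContDiffOn ℝ 1 f X) {x : Euc n} (hx : x ∈ X) :
    ∃ δ > 0, ∃ α : Euc n → ℝ → Euc n,
      (∀ᶠ y in 𝓝 x, IsSolutionOn X f y (Ioo (-δ) δ) (α y)) ∧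
      ∀ t ∈ Ioo (-δ) δ, ContinuousAt (fun y ↦ α y t) x := by
  obtain ⟨δ, hδ, α, hα, hcont⟩ :=
    exists_flow_mapsTo (hf.contDiffAt (hX.mem_nhds hx)) (hX.mem_nhds hx)
  refine ⟨δ, hδ, α, hα.mono fun y ⟨hinit, hmaps, hderiv⟩ ↦ ?_, hcont⟩
  exact ⟨isOpen_Ioo, ordConnected_Ioo, ⟨neg_lt_zero.2 hδ, hδ⟩, hinit, hmaps,
    fun t ht ↦ (hderiv t ht).hasDerivWithinAt⟩

theorem isEquilibrium_of_eq_zero (hX : IsOpen X) (hf : ContDiffOn ℝ 1 f X) {x : Euc n}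
    (hx : x ∈ X) (hfx : f x = 0) : IsEquilibrium X f x := by
  have hconst : IsSolutionOn X f x univ (fun _ ↦ x) :=
    ⟨isOpen_univ, ordConnected_univ, mem_univ _, rfl, fun _ _ ↦ hx, fun t _ ↦ by
      simpa only [hfx] using hasDerivWithinAt_const t univ x⟩
  exact ⟨hx, fun t ↦ ⟨⟨univ, _, hconst, mem_univ t⟩, hconst.flow_eq hX hf (mem_univ t)⟩⟩

theorem IsFirstIntegral.fderiv_apply_eq_zero (hX : IsOpen X) (hf : ContDiffOn ℝ 1 f X)
    (hint : IsFirstIntegral X f H) {x : Euc n} (hx : x ∈ X) (hH : DifferentiableAt ℝ H x) :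
    fderiv ℝ H x (f x) = 0 := by
  obtain ⟨δ, -, α, hα, -⟩ := exists_local_flow hX hf hx
  have hsol : IsSolutionOn X f x (Ioo (-δ) δ) (α x) := hα.self_of_nhds
  have hderiv : HasDerivAt (H ∘ α x) (fderiv ℝ H x (f x)) 0 := by
    have hvelocity := hsol.hasDerivAt hsol.zero_mem
    rw [hsol.initial] at hvelocity
    exact hH.hasFDerivAt.comp_hasDerivAt_of_eq 0 hvelocity hsol.initial.symm
  have hconst : H ∘ α x =ᶠ[𝓝 0] fun _ ↦ H x := by
    filter_upwards [hsol.isOpen.mem_nhds hsol.zero_mem] with t ht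
    rw [Function.comp_apply, ← hsol.flow_eq hX hf ht]
    exact hint.2 x hx t ⟨_, _, hsol, ht⟩
  exact hderiv.unique ((hasDerivAt_const 0 (H x)).congr_of_eventuallyEq hconst)

/-- The ascending part of the derivative `∑ ∂H/∂xⁱ · fⁱ` of `H` along the flow. For a first integral
the ascending and descending parts balance, so this is half the Finsler length
`∑ ∂H/∂xⁱ · |fⁱ|` of `f`. -/
noncomputable def ascentRate (f : Euc n → Euc n) (H : Euc n → ℝ) (y : Euc n) : ℝ :=
  ∑ i, gradient H y i * max (f y i) 0

theorem ascentRate_eq_sum (f : Euc n → Euc n) (H : Euc n → ℝ) (y : Euc n) :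
    ascentRate f H y = ∑ i with 0 < f y i, gradient H y i * f y i := by
  rw [ascentRate, Finset.sum_filter]
  refine Finset.sum_congr rfl fun i _ ↦ ?_
  split_ifs with hi
  · rw [max_eq_left hi.le]
  · rw [max_eq_right (not_lt.1 hi), mul_zero]

theorem HasPositiveGradient.sum_le_ascentRate (hgrad : HasPositiveGradient X H) {y : Euc n}
    (hy : y ∈ X) (S : Finset (Fin n)) : ∑ i ∈ S, gradient H y i * f y i ≤ ascentRate f H y :=
  calc ∑ i ∈ S, gradient H y i * f y i
      ≤ ∑ i ∈ S, gradient H y i * max (f y i) 0 := Finset.sum_le_sum fun i _ ↦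
        mul_le_mul_of_nonneg_left (le_max_left _ _) (hgrad y hy i).le
    _ ≤ ascentRate f H y := Finset.sum_le_univ_sum_of_nonneg fun i ↦
        mul_nonneg (hgrad y hy i).le (le_max_right _ _)

theorem continuousOn_ascentRate (hX : IsOpen X) (hf : ContinuousOn f X)
    (hH : ContDiffOn ℝ 1 H X) : ContinuousOn (ascentRate f H) X := by
  have hfderiv : ContinuousOn (fderiv ℝ H) X := hH.continuousOn_fderiv_of_isOpen hX le_rfl
  unfold ascentRate
  simp only [← fderiv_single]
  fun_prop

namespace IsSolutionOn

variable {x : Euc n} {J : Set ℝ} {γ : ℝ → Euc n}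

theorem hasDerivAt_vectorField (hX : IsOpen X) (hf : ContDiffOn ℝ 1 f X)
    (h : IsSolutionOn X f x J γ) {t : ℝ} (ht : t ∈ J) (i : Fin n) :
    HasDerivAt (fun s ↦ f (γ s) i) ((jacobian f (γ t) *ᵥ f (γ t)) i) t := by
  have hfderiv : HasFDerivAt f (fderiv ℝ f (γ t)) (γ t) :=
    ((hf.contDiffAt (hX.mem_nhds (h.mapsTo ht))).differentiableAt (by simp)).hasFDerivAt
  rw [← fderiv_apply_eq_mulVec]
  exact (EuclideanSpace.proj (𝕜 := ℝ) i).hasFDerivAt.comp_hasDerivAt t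
    (hfderiv.comp_hasDerivAt t (h.hasDerivAt ht))

theorem hasDerivAt_gradient (hX : IsOpen X) (hf : ContDiffOn ℝ 1 f X) (hH : ContDiffOn ℝ 1 H X)
    (hint : IsFirstIntegral X f H) (h : IsSolutionOn X f x J γ) {t : ℝ} (ht : t ∈ J) (i : Fin n) :
    HasDerivAt (fun s ↦ gradient H (γ s) i)
      (-((gradient H (γ t)).ofLp ᵥ* jacobian f (γ t)) i) t := by
  have hXt : X ∈ 𝓝 (γ t) := hX.mem_nhds (h.mapsTo ht)
  have hstrict : HasStrictFDerivAt f (fderiv ℝ f (γ t)) (γ t) :=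
    (hf.contDiffAt hXt).hasStrictFDerivAt (by simp)
  have hzero : ∀ᶠ y in 𝓝 (γ t), fderiv ℝ H y (f y) = 0 := by
    filter_upwards [hXt] with y hy
    exact hint.fderiv_apply_eq_zero hX hf hy
      ((hH.contDiffAt (hX.mem_nhds hy)).differentiableAt (by simp))
  have hadjoint := hasDerivAt_fderiv_apply_of_isIntegralCurveAt (h.isIntegralCurveAt ht) hstrict
    (hH.contDiffAt hXt) hzero (EuclideanSpace.single i 1)
  simp only [fderiv_single] at hadjoint
  rwa [fderiv_apply_eq_dotProduct] at hadjoint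

theorem hasDerivAt_sum_gradient_mul (hX : IsOpen X) (hf : ContDiffOn ℝ 1 f X)
    (hH : ContDiffOn ℝ 1 H X) (hint : IsFirstIntegral X f H) (h : IsSolutionOn X f x J γ) {t : ℝ}
    (ht : t ∈ J) (S : Finset (Fin n)) :
    HasDerivAt (fun s ↦ ∑ i ∈ S, gradient H (γ s) i * f (γ s) i)
      (∑ i ∈ S, (gradient H (γ t) i * (jacobian f (γ t) *ᵥ f (γ t)) i
        - ((gradient H (γ t)).ofLp ᵥ* jacobian f (γ t)) i * f (γ t) i)) t := by
  refine HasDerivAt.fun_sum fun i _ ↦ ?_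
  refine ((h.hasDerivAt_gradient hX hf hH hint ht i).mul
    (h.hasDerivAt_vectorField hX hf ht i)).congr_deriv ?_
  ring

theorem eventually_ascentRate_lt_left (hX : IsOpen X) (hf : ContDiffOn ℝ 1 f X)
    (hcoop : IsCooperative X f) (hirr : IsIrreducibleSystem X f) (hH : ContDiffOn ℝ 1 H X)
    (hint : IsFirstIntegral X f H) (hgrad : HasPositiveGradient X H)
    (h : IsSolutionOn X f x J γ) {t : ℝ} (ht : t ∈ J) (hft : f (γ t) ≠ 0) :
    ∀ᶠ s in 𝓝[<] t, ascentRate f H (γ t) < ascentRate f H (γ s) := by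
  have hXt : γ t ∈ X := h.mapsTo ht
  have hbalance : (gradient H (γ t)).ofLp ⬝ᵥ f (γ t) = 0 := by
    rw [← fderiv_apply_eq_dotProduct]
    exact hint.fderiv_apply_eq_zero hX hf hXt
      ((hH.contDiffAt (hX.mem_nhds hXt)).differentiableAt (by simp))
  have hneg := (hirr _ hXt).sum_mul_mulVec_sub_vecMul_mul_neg (hcoop _ hXt) (hgrad _ hXt)
    (WithLp.ofLp_eq_zero 2 |>.not.2 hft) hbalance
  filter_upwards [eventually_lt_left_of_hasDerivAt_neg
      (h.hasDerivAt_sum_gradient_mul hX hf hH hint ht {i | 0 < f (γ t) i}) hneg,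
    mem_nhdsWithin_of_mem_nhds (h.isOpen.mem_nhds ht)] with s hlt hs
  calc ascentRate f H (γ t)
      = ∑ i with 0 < f (γ t) i, gradient H (γ t) i * f (γ t) i := ascentRate_eq_sum f H (γ t)
    _ < ∑ i with 0 < f (γ t) i, gradient H (γ s) i * f (γ s) i := hlt
    _ ≤ ascentRate f H (γ s) := hgrad.sum_le_ascentRate (h.mapsTo hs) _

end IsSolutionOn

/-- A strict Lyapunov function of `ẋ = f(x)` on `X`: it is continuous and strictly decreases along
every solution which does not start at a zero of `f`. -/
structure IsStrictLyapunov (X : Set (Euc n)) (f : Euc n → Euc n) (L : Euc n → ℝ) : Prop where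
  continuousOn : ContinuousOn L X
  strictAntiOn : ∀ {x J γ}, IsSolutionOn X f x J γ → f x ≠ 0 → StrictAntiOn (L ∘ γ) J

theorem isStrictLyapunov_ascentRate (hX : IsOpen X) (hf : ContDiffOn ℝ 1 f X)
    (hcoop : IsCooperative X f) (hirr : IsIrreducibleSystem X f) (hH : ContDiffOn ℝ 1 H X)
    (hint : IsFirstIntegral X f H) (hgrad : HasPositiveGradient X H) :
    IsStrictLyapunov X f (ascentRate f H) where
  continuousOn := continuousOn_ascentRate hX hf.continuousOn hH
  strictAntiOn h hfx := strictAntiOn_of_frequently_lt_left h.ordConnected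
    ((continuousOn_ascentRate hX hf.continuousOn hH).comp h.isIntegralCurveOn.continuousOn h.mapsTo)
    fun _ ht ↦ (h.eventually_ascentRate_lt_left hX hf hcoop hirr hH hint hgrad ht
      (h.vectorField_ne_zero hX hf hfx ht)).frequently

theorem IsNonwandering.exists_isSolutionOn (hX : IsOpen X) (hf : ContDiffOn ℝ 1 f X) {x : Euc n}
    (hnw : IsNonwandering X f x) {T : ℝ} (hT : 0 < T) (hexit : (T : EReal) < exitTime X f x)
    (hentry : entryTime X f x < ((-T : ℝ) : EReal)) {U : Set (Euc n)} (hU : U ∈ 𝓝 x) :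
    ∃ y ∈ U, ∃ J γ, IsSolutionOn X f y J γ ∧ ∃ θ ∈ J, T < θ ∧ γ θ ∈ U := by
  obtain ⟨ε, hε, hball⟩ := Metric.mem_nhds_iff.1 hU
  have mem_U : ∀ {y}, ‖x - y‖ < ε → y ∈ U := fun hy ↦
    hball (by rwa [mem_ball_iff_norm, norm_sub_rev])
  rcases hnw with ⟨-, hfwd⟩ | ⟨-, hbwd⟩
  · obtain ⟨y, -, -, θ, hTθ, hθ, hy, hflow⟩ := hfwd ε hε T hT hexit
    obtain ⟨J, γ, hγ, hθJ⟩ := exists_isSolutionOn_of_lt_exitTime (hT.trans hTθ).le hθ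
    rw [hγ.flow_eq hX hf hθJ] at hflow
    exact ⟨y, mem_U hy, J, γ, hγ, θ, hθJ, hTθ, mem_U hflow⟩
  · obtain ⟨y, -, -, θ, hθ, hθT, hy, hflow⟩ := hbwd ε hε (-T) (neg_lt_zero.2 hT) hentry
    obtain ⟨J, γ, hγ, hθJ⟩ :=
      exists_isSolutionOn_of_entryTime_lt (hθT.trans (neg_lt_zero.2 hT)).le hθ
    rw [hγ.flow_eq hX hf hθJ] at hflow
    refine ⟨γ θ, mem_U hflow, _, _, hγ.shift hθJ, -θ, ?_, lt_neg_of_lt_neg hθT, ?_⟩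
    · simpa using hγ.zero_mem
    · simpa [hγ.initial] using mem_U hy

theorem IsStrictLyapunov.eq_zero_of_isNonwandering (hX : IsOpen X) (hf : ContDiffOn ℝ 1 f X)
    (hL : IsStrictLyapunov X f L) {x : Euc n} (hx : x ∈ X) (hnw : IsNonwandering X f x) :
    f x = 0 := by
  by_contra hfx
  obtain ⟨δ, hδ, α, hα, hαcont⟩ := exists_local_flow hX hf hx
  have hsol : IsSolutionOn X f x (Ioo (-δ) δ) (α x) := hα.self_of_nhds
  obtain ⟨T, hT, hTδ⟩ := exists_between hδ
  have hTmem : T ∈ Ioo (-δ) δ := ⟨(neg_lt_zero.2 hδ).trans hT, hTδ⟩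
  have hdrop : L (α x T) < L x := by
    simpa [hsol.initial] using hL.strictAntiOn hsol hfx hsol.zero_mem hTmem hT
  obtain ⟨c, hTc, hcx⟩ := exists_between hdrop
  have continuousAt : ∀ {y}, y ∈ X → ContinuousAt L y := fun hy ↦
    hL.continuousOn.continuousAt (hX.mem_nhds hy)
  have hnear : ∀ᶠ y in 𝓝 x, (IsSolutionOn X f y (Ioo (-δ) δ) (α y) ∧ f y ≠ 0) ∧
      L (α y T) < c ∧ c < L y := by
    refine (hα.and ?_).and (Eventually.and ?_ ((continuousAt hx).eventually_const_lt hcx))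
    · exact (hf.continuousOn.continuousAt (hX.mem_nhds hx)).eventually_ne hfx
    · exact ((continuousAt (hsol.mapsTo hTmem)).comp (f := fun y ↦ α y T)
        (hαcont T hTmem)).eventually_lt_const hTc
  obtain ⟨y, ⟨⟨hsoly, hfy⟩, hTy, -⟩, J, γ, hγ, θ, hθ, hTθ, ⟨-, -, hθc⟩⟩ :=
    hnw.exists_isSolutionOn hX hf hT (hsol.lt_exitTime hTmem)
      (hsol.entryTime_lt ⟨neg_lt_neg hTδ, neg_lt_of_neg_lt hTmem.1⟩) hnear
  have hTJ : T ∈ J := hγ.ordConnected.out hγ.zero_mem hθ ⟨hT.le, hTθ.le⟩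
  have hreturn : L (γ θ) < c :=
    calc L (γ θ) < L (γ T) := hL.strictAntiOn hγ hfy hTJ hθ hTθ
      _ = L (α y T) := by rw [hγ.eqOn hX hf hsoly ⟨hTJ, hTmem⟩]
      _ < c := hTy
  exact hreturn.not_gt hθc

end CoopODE

theorem theorem7 (n : ℕ) (X : Set (CoopODE.Euc n)) (hX : IsOpen X)
    (f : CoopODE.Euc n → CoopODE.Euc n) (hf : ContDiffOn ℝ 1 f X)
    (hcoop : CoopODE.IsCooperative X f) (hirr : CoopODE.IsIrreducibleSystem X f)
    (H : CoopODE.Euc n → ℝ) (hH : ContDiffOn ℝ 1 H X)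
    (hint : CoopODE.IsFirstIntegral X f H) (hgrad : CoopODE.HasPositiveGradient X H) :
    ∀ x : CoopODE.Euc n, CoopODE.IsNonwandering X f x → CoopODE.IsEquilibrium X f x := by
  intro x hnw
  have hx : x ∈ X := hnw.elim And.left And.left
  have hlyapunov : CoopODE.IsStrictLyapunov X f (CoopODE.ascentRate f H) :=
    CoopODE.isStrictLyapunov_ascentRate hX hf hcoop hirr hH hint hgrad
  have hfx : f x = 0 := hlyapunov.eq_zero_of_isNonwandering hX hf hx hnw
  exact CoopODE.isEquilibrium_of_eq_zero hX hf hx hfx
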